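/- Let $\mathbb{K}$ be a field of characteristic $0$ with algebraic closure $\overline{\mathbb{K}}$. For a commutative ring $R$, let $R^{\rm fr}[[t]]$ denote the ring of fractional power series $\sum_{n\ge 0} a_n t^{n/d}$, with $a_n\in R$ and some integer $d\ge 1$ depending on the series. For $\Phi(t,u)=\sum_{n\ge0} t^{n/d}\phi_n(u)\in\overline{\mathbb{K}}[u]^{\rm fr}[[t]]$ and $U\in\overline{\mathbb{K}}^{\rm fr}[[t]]$, put $\Phi(t,U)=\sum_{n\ge0} t^{n/d}\phi_n(U)\in\overline{\mathbb{K}}^{\rm fr}[[t]]$. We say that $U$ is a root of multiplicity $m$ of $\Phi$ if $\Phi(t,u)=(u-U)^m\Psi(t,u)$ for some $\Psi\in\overline{\mathbb{K}}[u]^{\rm fr}[[t]]$ with $\Psi(t,U)\neq0$. Let $k\ge 0$, let $P(x_0,x_1,\dots,x_k,t,v)$ be a polynomial with coefficients in $\mathbb{K}$ whose degree $n$ in $x_0$ is at least $2$, and let $P'_0=\partial P/\partial x_0$. Let $F(u)\equiv F(t,u)\in\mathbb{K}[u][[t]]$ and $F_1,\dots,F_k\in\mathbb{K}[[t]]$ satisfy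 $$P(F(u),F_1,\dots,F_k,t,u)=0.$$ Let $\Delta(x_1,\dots,x_k,t,v)$ be the discriminant of $P$ with respect to $x_0$ (the usual discriminant of a polynomial of degree $n$ in $x_0$, a polynomial in the coefficients of $P$). 1. Let $\ell\ge1$ and let $U\in\overline{\mathbb{K}}^{\rm fr}[[t]]$ be a root of multiplicity $\ell$ of $P'_0(F(u),F_1,\dots,F_k,t,u)$. Then, as a polynomial in $v$ with coefficients in $\overline{\mathbb{K}}^{\rm fr}[[t]]$, $\Delta(F_1,\dots,F_k,t,v)$ admits $U$ as a root of multiplicity at least $2\ell$, that is, it is divisible by $(v-U)^{2\ell}$. In other words, for $0\le i\le 2\ell-1$, $$\frac{\partial^i\Delta}{\partial v^i}(F_1,\dots,F_k,t,U)=0.$$ 2. Consequently, if $U_1,\dots,U_k\in\overline{\mathbb{K}}^{\rm fr}[[t]]$ (for instance, $k$ distinct series) satisfy $P'_0(F(U_i),F_1,\dots,F_k,t,U_i)=0$ for $1\le i\le k$, then the following $2k$ equations, which do not involve the series $F(U_i)$, hold: $$\Delta(F_1,\dots,F_k,t,U_i)=0,\qquad \frac{\partial\Delta}{\partial v}(F_1,\dots,F_k,t,U_i)=0\qquad(1\le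 i\le k).$$ -/

import Mathlib

noncomputable section

open Polynomial

/-- The additive monoid `(1/d) ℕ` of rational exponents `n / d`, `n ≥ 0`. -/
def fracExp (d : ℕ) : AddSubmonoid ℚ where
  carrier := {q | ∃ n : ℕ, q = (n : ℚ) / d}
  zero_mem' := ⟨0, by simp⟩
  add_mem' := by
    rintro _ _ ⟨m, rfl⟩ ⟨n, rfl⟩
    exact ⟨m + n, by push_cast; ring⟩

theorem fracExp_le_mul_right (d : ℕ) {e : ℕ} (he : 0 < e) : fracExp d ≤ fracExp (d * e) := by
  rintro _ ⟨n, rfl⟩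
  refine ⟨n * e, ?_⟩
  have : (e : ℚ) ≠ 0 := by positivity
  push_cast
  rw [mul_div_mul_right _ _ this]

theorem fracExp_le_mul_left (d : ℕ) {e : ℕ} (he : 0 < e) : fracExp d ≤ fracExp (e * d) := by
  rw [mul_comm]
  exact fracExp_le_mul_right d he

theorem fracExp_isPWO (d : ℕ) : (fracExp d : Set ℚ).IsPWO := by
  have h : (fracExp d : Set ℚ) = (fun n : ℕ => (n : ℚ) / d) '' Set.univ := by
    ext q
    constructor
    · rintro ⟨n, rfl⟩
      exact ⟨n, trivial, rfl⟩
    · rintro ⟨n, -, rfl⟩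
      exact ⟨n, rfl⟩
  rw [h]
  refine Set.IsPWO.image_of_monotone (Set.isWF_univ_iff.2 inferInstance).isPWO ?_
  intro a b hab
  simp only
  gcongr

theorem fracExp_finite_le {d : ℕ} (hd : 0 < d) (q : ℚ) :
    {p : ℚ | p ∈ fracExp d ∧ p ≤ q}.Finite := by
  have hd' : (0 : ℚ) < d := by exact_mod_cast hd
  refine ((Set.finite_Iic ⌊q * d⌋₊).image (fun n : ℕ => (n : ℚ) / d)).subset ?_
  rintro _ ⟨⟨n, rfl⟩, hn⟩
  exact ⟨n, Nat.le_floor ((div_le_iff₀ hd').1 hn), rfl⟩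

section

variable (R : Type*) [CommRing R]

/-- `R[[t^{1/d}]]`: series in `t` whose exponents all lie in `(1/d) ℕ`. -/
def FracLevel (d : ℕ) : Subring (HahnSeries ℚ R) where
  carrier := {f | f.support ⊆ fracExp d}
  zero_mem' := by simp
  one_mem' := by
    intro q hq
    have h : q = 0 := HahnSeries.support_single_subset hq
    rw [h]
    exact (fracExp d).zero_mem
  add_mem' := by
    intro f g hf hg
    exact (HahnSeries.support_add_subset f g).trans (Set.union_subset hf hg)
  neg_mem' := by
    intro f hf
    simpa using hf
  mul_mem' := by
    intro f g hf hg q hq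
    obtain ⟨a, ha, b, hb, rfl⟩ := HahnSeries.support_mul_subset hq
    exact (fracExp d).add_mem (hf ha) (hg hb)

/-- The ring `R^fr[[t]]` of fractional power series in `t` with coefficients in `R`: the series
`∑_{n ≥ 0} a_n t^{n/d}` for some integer `d ≥ 1` (depending on the series). -/
def FracPowerSeries : Subring (HahnSeries ℚ R) where
  carrier := {f | ∃ d : ℕ, 0 < d ∧ f ∈ FracLevel R d}
  zero_mem' := ⟨1, one_pos, zero_mem _⟩
  one_mem' := ⟨1, one_pos, one_mem _⟩
  add_mem' := by
    rintro f g ⟨d, hd, hf⟩ ⟨e, he, hg⟩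
    exact ⟨d * e, Nat.mul_pos hd he, add_mem
      (S := Subring (HahnSeries ℚ R)) (s := FracLevel R (d * e))
      (Set.Subset.trans hf (fracExp_le_mul_right d he))
      (Set.Subset.trans hg (fracExp_le_mul_left e hd))⟩
  neg_mem' := by
    rintro f ⟨d, hd, hf⟩
    exact ⟨d, hd, neg_mem hf⟩
  mul_mem' := by
    rintro f g ⟨d, hd, hf⟩ ⟨e, he, hg⟩
    exact ⟨d * e, Nat.mul_pos hd he, mul_mem
      (S := Subring (HahnSeries ℚ R)) (s := FracLevel R (d * e))
      (Set.Subset.trans hf (fracExp_le_mul_right d he))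
      (Set.Subset.trans hg (fracExp_le_mul_left e hd))⟩

end

section

variable {R S : Type*} [CommRing R] [CommRing S]

theorem fracLevel_single {d : ℕ} {q : ℚ} (hq : q ∈ fracExp d) (r : R) :
    HahnSeries.single q r ∈ FracLevel R d := by
  intro p hp
  have h : p = q := HahnSeries.support_single_subset hp
  rwa [h]

/-- The inclusion `R ⊆ R^fr[[t]]` of constants. -/
def fracC : R →+* FracPowerSeries R :=
  (HahnSeries.C : R →+* HahnSeries ℚ R).codRestrict (FracPowerSeries R)
    (fun r => ⟨1, one_pos, fracLevel_single (fracExp 1).zero_mem r⟩)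

/-- The inclusion `R[[t]] ⊆ R^fr[[t]]`. -/
def fracOfPowerSeries : PowerSeries R →+* FracPowerSeries R :=
  (HahnSeries.ofPowerSeries ℚ R).codRestrict (FracPowerSeries R) (fun f => by
    refine ⟨1, one_pos, ?_⟩
    intro q hq
    rw [HahnSeries.ofPowerSeries_apply] at hq
    obtain ⟨n, -, rfl⟩ := HahnSeries.support_embDomain_subset hq
    exact ⟨n, by simp⟩)

/-- The map `R^fr[[t]] → S^fr[[t]]` applying `f : R → S` to every coefficient. -/
def fracMap (f : R →+* S) (a : FracPowerSeries R) : FracPowerSeries S :=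
  ⟨HahnSeries.map (a : HahnSeries ℚ R) f, by
    obtain ⟨d, hd, h⟩ := a.2
    refine ⟨d, hd, fun q hq => h fun h0 => hq ?_⟩
    simp [h0]⟩

/-- The value at `u = U` of a polynomial `φ(u)` with coefficients in `R`. -/
def fracEval (U : FracPowerSeries R) (φ : R[X]) : FracPowerSeries R :=
  φ.eval₂ fracC U

theorem fracEval_mem_level {d : ℕ} {U : FracPowerSeries R}
    (hU : (U : HahnSeries ℚ R) ∈ FracLevel R d) (φ : R[X]) :
    (fracEval U φ : HahnSeries ℚ R) ∈ FracLevel R d := by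
  have h : (fracEval U φ : HahnSeries ℚ R) = φ.sum fun n a =>
      HahnSeries.C a * (U : HahnSeries ℚ R) ^ n := by
    unfold fracEval
    rw [eval₂_eq_sum, Polynomial.sum, Polynomial.sum]
    push_cast
    rfl
  rw [h]
  exact sum_mem fun n _ => mul_mem (fracLevel_single (fracExp d).zero_mem _) (pow_mem hU n)

theorem substTerm_mem_level {d e : ℕ} (hd : 0 < d) (he : 0 < e) {U : FracPowerSeries R}
    {Φ : FracPowerSeries R[X]} (hU : (U : HahnSeries ℚ R) ∈ FracLevel R d)
    (hΦ : (Φ : HahnSeries ℚ R[X]) ∈ FracLevel R[X] e) (p : ℚ) :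
    HahnSeries.single p (1 : R) *
      (fracEval U ((Φ : HahnSeries ℚ R[X]).coeff p) : HahnSeries ℚ R) ∈ FracLevel R (d * e) := by
  by_cases hp : (Φ : HahnSeries ℚ R[X]).coeff p = 0
  · simp [hp, fracEval]
  · exact mul_mem (fracLevel_single (fracExp_le_mul_left e hd (hΦ hp)) 1)
      (Set.Subset.trans (fracEval_mem_level hU _) (fracExp_le_mul_right d he))

theorem substTerm_coeff_ne_zero {d e : ℕ} {U : FracPowerSeries R}
    {Φ : FracPowerSeries R[X]} (hU : (U : HahnSeries ℚ R) ∈ FracLevel R d)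
    (hΦ : (Φ : HahnSeries ℚ R[X]) ∈ FracLevel R[X] e) {p q : ℚ}
    (h : (HahnSeries.single p (1 : R) *
      (fracEval U ((Φ : HahnSeries ℚ R[X]).coeff p) : HahnSeries ℚ R)).coeff q ≠ 0) :
    p ∈ fracExp e ∧ p ≤ q := by
  constructor
  · have hp : (Φ : HahnSeries ℚ R[X]).coeff p ≠ 0 := by
      intro h0
      rw [h0] at h
      simp [fracEval] at h
    exact hΦ hp
  · obtain ⟨a, ha, b, hb, hab⟩ := HahnSeries.support_mul_subset h
    have ha' : a = p := HahnSeries.support_single_subset ha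
    obtain ⟨n, hn⟩ := fracEval_mem_level hU _ hb
    have hb0 : 0 ≤ b := by rw [hn]; positivity
    have hab' : a + b = q := hab
    linarith

/-- The family of terms `t^p φ_p(U)`, for `Φ(t,u) = ∑_p t^p φ_p(u)`. -/
def substFamily (U : FracPowerSeries R) (Φ : FracPowerSeries R[X]) :
    HahnSeries.SummableFamily ℚ R ℚ where
  toFun p := HahnSeries.single p (1 : R) *
    (fracEval U ((Φ : HahnSeries ℚ R[X]).coeff p) : HahnSeries ℚ R)
  isPWO_iUnion_support' := by
    obtain ⟨d, hd, hU⟩ := U.2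
    obtain ⟨e, he, hΦ⟩ := Φ.2
    exact (fracExp_isPWO (d * e)).mono
      (Set.iUnion_subset fun p => substTerm_mem_level hd he hU hΦ p)
  finite_co_support' := by
    obtain ⟨d, hd, hU⟩ := U.2
    obtain ⟨e, he, hΦ⟩ := Φ.2
    intro q
    exact (fracExp_finite_le he q).subset fun p hp => substTerm_coeff_ne_zero hU hΦ hp

/-- The substitution `Φ(t,U) = ∑_p t^p φ_p(U)` of `U ∈ R^fr[[t]]` for `u` in
`Φ(t,u) = ∑_p t^p φ_p(u) ∈ R[u]^fr[[t]]`. -/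
def fracSubst (U : FracPowerSeries R) (Φ : FracPowerSeries R[X]) : FracPowerSeries R :=
  ⟨(substFamily U Φ).hsum, by
    obtain ⟨d, hd, hU⟩ := U.2
    obtain ⟨e, he, hΦ⟩ := Φ.2
    refine ⟨d * e, Nat.mul_pos hd he, fun q hq => ?_⟩
    by_contra hq'
    refine hq ?_
    rw [HahnSeries.SummableFamily.coeff_hsum]
    refine finsum_eq_zero_of_forall_eq_zero fun p => ?_
    by_contra h
    exact hq' (substTerm_mem_level hd he hU hΦ p h)⟩

/-- `U ∈ R^fr[[t]]` is a root of multiplicity `m` of `Φ(t,u) ∈ R[u]^fr[[t]]`: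
`Φ(t,u) = (u - U)^m Ψ(t,u)` with `Ψ(t,u) ∈ R[u]^fr[[t]]` and `Ψ(t,U) ≠ 0`. -/
def IsRootOfMultiplicity (U : FracPowerSeries R) (m : ℕ) (Φ : FracPowerSeries R[X]) : Prop :=
  ∃ Ψ : FracPowerSeries R[X],
    Φ = (fracC (X : R[X]) - fracMap (C : R →+* R[X]) U) ^ m * Ψ ∧ fracSubst U Ψ ≠ 0

end

/-- The tuple `(x_1, …, x_k, t, v)`. -/
def paramPoint {A : Type*} {k : ℕ} (x : Fin k → A) (t v : A) : Fin (k + 2) → A :=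
  Fin.snoc (Fin.snoc x t : Fin (k + 1) → A) v

/-- The tuple `(x_0, x_1, …, x_k, t, v)`. -/
def fullPoint {A : Type*} {k : ℕ} (x₀ : A) (x : Fin k → A) (t v : A) : Fin (k + 3) → A :=
  Fin.cons x₀ (paramPoint x t v)

section

variable {K : Type*} [Field K] {k : ℕ}

/-- For `Q(x_0, …, x_k, t, v)` with coefficients in `K`, `F ∈ K[u][[t]]` and `F_i ∈ K[[t]]`, the
series `Q(F(u), F_1, …, F_k, t, u) ∈ K[u][[t]]`. -/
def evalSeries (Q : MvPolynomial (Fin (k + 3)) K) (F : PowerSeries K[X])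
    (Fs : Fin k → PowerSeries K) : PowerSeries K[X] :=
  Q.eval₂ ((PowerSeries.C).comp (C : K →+* K[X]))
    (fullPoint F (fun i => PowerSeries.map (C : K →+* K[X]) (Fs i)) PowerSeries.X
      (PowerSeries.C (X : K[X])))

/-- The discriminant `Δ(x_1, …, x_k, t, v)` of `P(x_0, x_1, …, x_k, t, v)` with respect to
`x_0`. -/
def discr₀ (P : MvPolynomial (Fin (k + 3)) K) : MvPolynomial (Fin (k + 2)) K :=
  (MvPolynomial.finSuccEquiv K (k + 2) P).discr

/-- The inclusion `K ⊆ K̄^fr[[t]]`. -/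
def constK : K →+* FracPowerSeries (AlgebraicClosure K) :=
  (fracC).comp (algebraMap K (AlgebraicClosure K))

/-- The inclusion `K[[t]] ⊆ K̄^fr[[t]]`. -/
def seriesK : PowerSeries K →+* FracPowerSeries (AlgebraicClosure K) :=
  (fracOfPowerSeries).comp (PowerSeries.map (algebraMap K (AlgebraicClosure K)))

/-- The inclusion `K[u][[t]] ⊆ K̄[u]^fr[[t]]`. -/
def seriesKu : PowerSeries K[X] →+* FracPowerSeries (AlgebraicClosure K)[X] :=
  (fracOfPowerSeries).comp (PowerSeries.map (mapRingHom (algebraMap K (AlgebraicClosure K))))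

/-- The value `Q(y, F_1, …, F_k, t, U) ∈ K̄^fr[[t]]`, for `y, U ∈ K̄^fr[[t]]`. -/
def evalFull (Q : MvPolynomial (Fin (k + 3)) K) (y : FracPowerSeries (AlgebraicClosure K))
    (Fs : Fin k → PowerSeries K) (U : FracPowerSeries (AlgebraicClosure K)) :
    FracPowerSeries (AlgebraicClosure K) :=
  Q.eval₂ constK (fullPoint y (fun i => seriesK (Fs i)) (seriesK PowerSeries.X) U)

/-- The value `D(F_1, …, F_k, t, U) ∈ K̄^fr[[t]]`, for `U ∈ K̄^fr[[t]]`. -/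
def evalParam (D : MvPolynomial (Fin (k + 2)) K) (Fs : Fin k → PowerSeries K)
    (U : FracPowerSeries (AlgebraicClosure K)) : FracPowerSeries (AlgebraicClosure K) :=
  D.eval₂ constK (paramPoint (fun i => seriesK (Fs i)) (seriesK PowerSeries.X) U)

/-- `D(F_1, …, F_k, t, v)` as a polynomial in `v` with coefficients in `K̄^fr[[t]]`. -/
def evalParamPoly (D : MvPolynomial (Fin (k + 2)) K) (Fs : Fin k → PowerSeries K) :
    (FracPowerSeries (AlgebraicClosure K))[X] :=
  D.eval₂ ((C).comp constK)
    (paramPoint (fun i => C (seriesK (Fs i))) (C (seriesK PowerSeries.X)) X)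

/-- The partial derivative `∂/∂v` of a polynomial in `x_1, …, x_k, t, v`. -/
def derivV (D : MvPolynomial (Fin (k + 2)) K) : MvPolynomial (Fin (k + 2)) K :=
  MvPolynomial.pderiv (Fin.last (k + 1)) D

end

end

/-! The core is a fact about any commutative ring: if `f(a) = 0` then `f'(a)²` divides the
discriminant of `f`. Writing `f = (X - a) h` gives `f'(a) = h(a)`, and multiplicativity of
resultants gives `disc f = ± h(a)² disc h`. This is `sq_eval_derivative_dvd_formalDiscr`.

Apply it to `P` as a polynomial in `x_0`, with root `F(u)`, in the ring `K̄[u]^fr[[t]]`: there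
`Δ(F_1, …, F_k, t, u)` is a multiple of `P'_0(F(u), …)²` (`sq_seriesKu_pderiv_dvd`). A factor `(u -
U)^l` of `P'_0` thus yields `(u - U)^(2l)` in `Δ`. The quotient is so far only a series with
polynomial coefficients; `pow_X_sub_C_dvd_of_fracOfPoly` makes it a polynomial in `v`. The second
claim follows by substituting `u = U` in `Δ = P'_0² D` and in its `u`-derivative. -/

open Polynomial

/-! ### Discriminants with a prescribed root -/

section Discriminant

variable {R S : Type*} [CommRing R] [CommRing S]

/-- The discriminant of `f` regarded as a polynomial of formal degree `n`. -/
noncomputable def formalDiscr (n : ℕ) (f : R[X]) : R :=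
  (if hn : n = 0 then (0 : Matrix (Fin (n - 1 + n)) (Fin (n - 1 + n)) R)
    -- Each entry of the last Sylvester row is a multiple of the coefficient of `X^n`; the
    -- replacement row is that row with this factor removed.
    else (f.derivative.sylvester f (n - 1) n).updateRow ⟨2 * n - 2, by lia⟩
      (fun j ↦ if ↑j = n - 2 then 1 else (if ↑j = 2 * n - 2 then (n : R) else 0))).det *
    (-1) ^ (n * (n - 1) / 2)

theorem formalDiscr_natDegree (f : R[X]) : formalDiscr f.natDegree f = f.discr := rfl

/-- Fixing the formal degree makes the matrix size independent of `φ`, so the identity survives when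
`φ` kills the leading coefficient. -/
theorem formalDiscr_map {n : ℕ} (hn : n ≠ 0) (φ : R →+* S) (f : R[X]) :
    formalDiscr n (f.map φ) = φ (formalDiscr n f) := by
  simp only [formalDiscr, dif_neg hn, map_mul, RingHom.map_det, map_pow, map_neg, map_one]
  congr 2
  rw [derivative_map, sylvester_map_map]
  ext i j
  simp only [RingHom.mapMatrix_apply, Matrix.map_apply, Matrix.updateRow_apply]
  split_ifs <;> simp

theorem resultant_mul_right_of_natDegree_le {f g₁ g₂ : R[X]} {m n₁ n₂ : ℕ}
    (hf : f.natDegree ≤ m) (h₁ : g₁.natDegree = n₁) (h₂ : g₂.natDegree ≤ n₂) :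
    resultant f (g₁ * g₂) m (n₁ + n₂) = resultant f g₁ m n₁ * resultant f g₂ m n₂ := by
  -- Raising the formal degree of `g₂` by `c` multiplies both sides by the same factor.
  obtain ⟨c, rfl⟩ := Nat.exists_eq_add_of_le h₂
  subst h₁
  rw [← add_assoc, resultant_add_right_deg _ _ _ _ _ natDegree_mul_le,
    resultant_mul_right _ _ _ _ hf, resultant_add_right_deg _ _ _ _ _ le_rfl]
  ring

/-- If `f = (X - a) h` with `deg h = n + 1` and the leading coefficient of `h` is regular, then the
discriminant of `f` is a multiple of `h(a)²`. -/
theorem sq_eval_dvd_discr_X_sub_C_mul {n : ℕ} (a : R) (h : R[X]) (hh : h.natDegree = n + 1)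
    (hreg : IsRegular h.leadingCoeff) : h.eval a ^ 2 ∣ ((X - C a) * h).discr := by
  nontriviality R
  set f := (X - C a) * h with hf
  have hdeg : f.natDegree = n + 2 := by
    rw [hf, (monic_X_sub_C a).natDegree_mul' (by rintro rfl; simp at hh), natDegree_X_sub_C, hh]
    ring
  have hlc : f.leadingCoeff = h.leadingCoeff := by
    rw [hf, leadingCoeff_monic_mul (monic_X_sub_C a)]
  have hder : f.derivative = (X - C a) * h.derivative + h * 1 := by
    rw [hf, derivative_mul]; simp; ring
  have hdh : h.derivative.natDegree ≤ n := by
    have := natDegree_derivative_le h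
    omega
  have hdf : f.derivative.natDegree ≤ n + 1 := by
    have := natDegree_derivative_le f
    omega
  -- Split off the factor `X - a` of `f`: its resultant with `f'` is `f'(a) = h(a)`.
  have h1 : resultant f f.derivative (n + 2) (n + 1) =
      h.eval a * resultant h f.derivative (n + 1) (n + 1) := by
    have := resultant_mul_left (X - C a) h f.derivative (n + 1) hdf
    rw [natDegree_X_sub_C, hh, ← hf, resultant_X_sub_C_left _ _ _ hdf] at this
    rw [show n + 2 = 1 + (n + 1) by ring, this, hder]
    simp
  -- Modulo `h`, `f'` is `(X - a) h'`, which yields the second factor `h(a)`.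
  have h2 : resultant h f.derivative (n + 1) (n + 1) =
      (-1) ^ (n + 1) * h.eval a * resultant h h.derivative (n + 1) n := by
    rw [hder, resultant_add_mul_right _ _ _ _ _ (by simp) hh.le,
      ← resultant_X_sub_C_right _ _ _ hh.le]
    rw [← resultant_mul_right_of_natDegree_le hh.le (natDegree_X_sub_C a) hdh, add_comm 1 n]
  have h3 := resultant_deriv (f := f) (natDegree_pos_iff_degree_pos.1 (by omega))
  have h4 := resultant_deriv (f := h) (natDegree_pos_iff_degree_pos.1 (by omega))
  rw [hdeg, show n + 2 - 1 = n + 1 by omega, h1, h2, hlc] at h3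
  rw [hh, show n + 1 - 1 = n by omega] at h4
  rw [h4] at h3
  generalize (n + 1) * n / 2 = e at h3
  generalize (n + 2) * (n + 1) / 2 = e' at h3
  -- `f` and `h` share their leading coefficient, which is regular and cancels from the two
  -- resultant formulas.
  have h5 : (-1) ^ e' * f.discr = (-1) ^ (n + 1) * (-1) ^ e * h.eval a ^ 2 * h.discr := by
    apply hreg.left
    simp only
    linear_combination -h3
  have h6 : ((-1 : R) ^ e') * (-1) ^ e' = 1 := by
    rw [← mul_pow]; simp
  refine ⟨(-1) ^ e' * (-1) ^ (n + 1) * (-1) ^ e * h.discr, ?_⟩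
  linear_combination (-1) ^ e' * h5 - f.discr * h6

/-- Here the coefficient of `X^(n+2)` may vanish or be a zero divisor. Since the formal discriminant
commutes with ring maps, `f` is deformed over `R[Y]` to a polynomial with regular leading
coefficient, and `Y = 0` is set at the end. -/
theorem sq_eval_derivative_dvd_formalDiscr {n : ℕ} (f : R[X]) (hf : f.natDegree ≤ n + 2) (a : R)
    (ha : f.eval a = 0) : f.derivative.eval a ^ 2 ∣ formalDiscr (n + 2) f := by
  nontriviality R
  obtain ⟨h, rfl⟩ := dvd_iff_isRoot.2 ha
  have hh : h.natDegree ≤ n + 1 := by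
    by_cases h0 : h = 0
    · simp [h0]
    rw [(monic_X_sub_C a).natDegree_mul' h0, natDegree_X_sub_C] at hf
    omega
  -- `H = h + Y X^(n+1)`, whose top coefficient is monic in `Y`, hence regular.
  let H : R[X][X] := h.map C + C X * X ^ (n + 1)
  have hHd : H.natDegree ≤ n + 1 := by
    refine natDegree_add_le_of_degree_le ((natDegree_map_le).trans hh) (natDegree_C_mul_X_pow_le _ _)
  have hcoeff : H.coeff (n + 1) = X + C (h.coeff (n + 1)) := by
    simp [H, add_comm]
  have hne : H.coeff (n + 1) ≠ 0 := by
    rw [hcoeff]; exact (monic_X_add_C _).ne_zero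
  have hHd' : H.natDegree = n + 1 := le_antisymm hHd (le_natDegree_of_ne_zero hne)
  have hreg : IsRegular H.leadingCoeff := by
    rw [leadingCoeff, hHd', hcoeff]; exact (monic_X_add_C _).isRegular
  have key := sq_eval_dvd_discr_X_sub_C_mul (C a) H hHd' hreg
  have hdeg : ((X - C (C a)) * H).natDegree = n + 2 := by
    rw [(monic_X_sub_C _).natDegree_mul' (by rintro h0; simp [h0] at hHd'), natDegree_X_sub_C, hHd']
    ring
  rw [← formalDiscr_natDegree, hdeg] at key
  have hmapH : H.map (evalRingHom 0) = h := by
    ext i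
    simp [H, Polynomial.map_map]
  have := map_dvd (evalRingHom (0 : R)) key
  rw [← formalDiscr_map (by omega), Polynomial.map_mul, hmapH, map_pow] at this
  convert this using 2
  · simp only [derivative_mul, derivative_sub, derivative_X, derivative_C, eval_add, eval_mul,
      eval_sub, eval_X, eval_C, sub_self, zero_mul, sub_zero, one_mul, add_zero]
    conv_lhs => rw [← hmapH]
    rw [show a = evalRingHom (0 : R) (C a) by simp, eval_map_apply]
    simp
  · simp

theorem sq_eval₂_derivative_dvd_map_discr (φ : R →+* S) (f : R[X]) (hf : 2 ≤ f.natDegree) (a : S)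
    (ha : f.eval₂ φ a = 0) : f.derivative.eval₂ φ a ^ 2 ∣ φ f.discr := by
  obtain ⟨n, hn⟩ := Nat.exists_eq_add_of_le' hf
  rw [← formalDiscr_natDegree, hn, ← formalDiscr_map (by omega), eval₂_eq_eval_map,
    ← derivative_map]
  exact sq_eval_derivative_dvd_formalDiscr _ (natDegree_map_le.trans hn.le) a
    (by rwa [eval_map])

end Discriminant

/-! ### Substitution and differentiation in fractional power series -/

section Substitution

variable {R S : Type*} [CommRing R] [CommRing S]

theorem coe_fracC (r : R) : (fracC r : HahnSeries ℚ R) = HahnSeries.single 0 r := rfl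

/-- `fracMap` as a ring homomorphism. -/
noncomputable def fracMapHom (f : R →+* S) : FracPowerSeries R →+* FracPowerSeries S where
  toFun := fracMap f
  map_one' := Subtype.ext <| by
    ext q
    simp [fracMap, HahnSeries.coeff_one, apply_ite f]
  map_mul' a b := Subtype.ext (HahnSeries.map_mul (f : R →ₙ+* S))
  map_zero' := Subtype.ext <| by
    ext q
    simp [fracMap]
  map_add' a b := Subtype.ext <| by
    ext q
    simp [fracMap]

/-- `fracEval` as a ring homomorphism in the polynomial. -/
noncomputable def fracEvalHom (U : FracPowerSeries R) : R[X] →+* HahnSeries ℚ R :=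
  (FracPowerSeries R).subtype.comp (eval₂RingHom fracC U)

theorem fracEvalHom_apply (U : FracPowerSeries R) (φ : R[X]) :
    fracEvalHom U φ = (fracEval U φ : HahnSeries ℚ R) := rfl

theorem substFamily_apply (U : FracPowerSeries R) (Φ : FracPowerSeries R[X]) (p : ℚ) :
    substFamily U Φ p = HahnSeries.single p (1 : R) *
      fracEvalHom U ((Φ : HahnSeries ℚ R[X]).coeff p) := rfl

theorem fracSubst_add (U : FracPowerSeries R) (Φ Ψ : FracPowerSeries R[X]) :
    fracSubst U (Φ + Ψ) = fracSubst U Φ + fracSubst U Ψ := by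
  refine Subtype.ext ?_
  change (substFamily U (Φ + Ψ)).hsum = (substFamily U Φ).hsum + (substFamily U Ψ).hsum
  rw [← HahnSeries.SummableFamily.hsum_add]
  congr 1
  ext1 p
  rw [HahnSeries.SummableFamily.add_apply]
  simp only [substFamily_apply, Subring.coe_add, HahnSeries.coeff_add, map_add, mul_add]

/-- Substitution in a series with at most one term. -/
theorem fracSubst_of_coeff_eq_zero (U : FracPowerSeries R) (Φ : FracPowerSeries R[X])
    (h : ∀ p ≠ 0, (Φ : HahnSeries ℚ R[X]).coeff p = 0) :
    fracSubst U Φ = fracEval U ((Φ : HahnSeries ℚ R[X]).coeff 0) := by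
  refine Subtype.ext ?_
  change (substFamily U Φ).hsum = _
  ext q
  rw [HahnSeries.SummableFamily.coeff_hsum, finsum_eq_single _ 0]
  · rw [substFamily_apply, ← HahnSeries.C_apply]
    simp [fracEvalHom_apply]
  · intro p hp
    rw [substFamily_apply, h p hp]
    simp

theorem fracSubst_fracC (U : FracPowerSeries R) (φ : R[X]) :
    fracSubst U (fracC φ) = fracEval U φ := by
  rw [fracSubst_of_coeff_eq_zero]
  · congr 1
    simp [coe_fracC]
  · intro p hp
    simp [coe_fracC, HahnSeries.coeff_single_of_ne hp]

theorem fracSubst_fracMap_C (U b : FracPowerSeries R) : fracSubst U (fracMap C b) = b := by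
  refine Subtype.ext ?_
  change (substFamily U (fracMap C b)).hsum = _
  ext q
  have h : ∀ p, (substFamily U (fracMap C b)) p =
      HahnSeries.single p ((b : HahnSeries ℚ R).coeff p) := by
    intro p
    rw [substFamily_apply]
    simp [fracMap, fracEvalHom, coe_fracC]
  rw [HahnSeries.SummableFamily.coeff_hsum, finsum_eq_single _ q]
  · rw [h]; simp
  · intro p hp
    rw [h, HahnSeries.coeff_single_of_ne hp.symm]

/-- For each exponent `q`, only finitely many terms reach `t^q`, so the identity reduces to
regrouping a finite double sum over pairs `(a, b)` by the value of `a + b`. -/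
theorem fracSubst_mul (U : FracPowerSeries R) (Φ Ψ : FracPowerSeries R[X]) :
    fracSubst U (Φ * Ψ) = fracSubst U Φ * fracSubst U Ψ := by
  classical
  refine Subtype.ext ?_
  change (substFamily U (Φ * Ψ)).hsum = (substFamily U Φ).hsum * (substFamily U Ψ).hsum
  rw [← HahnSeries.SummableFamily.hsum_mul]
  obtain ⟨d, hd, hU⟩ := U.2
  obtain ⟨e, he, hΦ⟩ : ∃ e : ℕ, 0 < e ∧ (Φ : HahnSeries ℚ R[X]) ∈ FracLevel R[X] e ∧
      (Ψ : HahnSeries ℚ R[X]) ∈ FracLevel R[X] e := by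
    obtain ⟨e, he, h⟩ := Φ.2
    obtain ⟨e', he', h'⟩ := Ψ.2
    exact ⟨e * e', Nat.mul_pos he he', Set.Subset.trans h (fracExp_le_mul_right e he'),
      Set.Subset.trans h' (fracExp_le_mul_left e' he)⟩
  obtain ⟨hΦ, hΨ⟩ := hΦ
  have hΦΨ : ((Φ * Ψ : FracPowerSeries R[X]) : HahnSeries ℚ R[X]) ∈ FracLevel R[X] e :=
    mul_mem hΦ hΨ
  ext q
  -- As `U` has only nonnegative exponents, `t^p φ_p(U)` contributes to `t^q` only if `p ≤ q`.
  let T : Finset ℚ := (fracExp_finite_le he q).toFinset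
  have hT : ∀ p, p ∈ T ↔ p ∈ fracExp e ∧ p ≤ q := fun p => by simp [T]
  have hterm : ∀ x : ℚ × ℚ, (HahnSeries.SummableFamily.mul (substFamily U Φ) (substFamily U Ψ)) x =
      HahnSeries.single (x.1 + x.2) 1 * fracEvalHom U
        ((Φ : HahnSeries ℚ R[X]).coeff x.1 * (Ψ : HahnSeries ℚ R[X]).coeff x.2) := by
    intro x
    have : HahnSeries.single (x.1 + x.2) (1 : R) =
        HahnSeries.single x.1 1 * HahnSeries.single x.2 1 := by simp
    rw [HahnSeries.SummableFamily.mul_toFun, substFamily_apply, substFamily_apply, map_mul, this]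
    ring
  have hnonneg : ∀ p ∈ fracExp e, 0 ≤ p := by
    rintro _ ⟨n, rfl⟩
    positivity
  have hsupp : ∀ x : ℚ × ℚ, ((HahnSeries.SummableFamily.mul (substFamily U Φ)
      (substFamily U Ψ)) x).coeff q ≠ 0 → x.1 ∈ T ∧ x.2 ∈ T ∧ x.1 + x.2 ∈ T := by
    intro x hx
    rw [hterm] at hx
    have h1 : x.1 ∈ fracExp e := hΦ fun h0 => hx (by simp [h0])
    have h2 : x.2 ∈ fracExp e := hΨ fun h0 => hx (by simp [h0])
    have h3 : x.1 + x.2 ≤ q := by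
      rw [HahnSeries.coeff_single_mul, one_mul] at hx
      obtain ⟨n, hn⟩ := fracEval_mem_level hU _ hx
      have : (0 : ℚ) ≤ n / d := by positivity
      linarith
    have := hnonneg _ h1
    have := hnonneg _ h2
    exact ⟨(hT _).2 ⟨h1, by linarith⟩, (hT _).2 ⟨h2, by linarith⟩,
      (hT _).2 ⟨add_mem h1 h2, h3⟩⟩
  have hT' : {p | (substFamily U (Φ * Ψ) p).coeff q ≠ 0} ⊆ T := fun p hp =>
    Finset.mem_coe.2 ((hT p).2 (substTerm_coeff_ne_zero hU hΦΨ hp))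
  rw [HahnSeries.SummableFamily.coeff_hsum_eq_sum_of_subset hT',
    HahnSeries.SummableFamily.coeff_hsum_eq_sum_of_subset
      (t := (T ×ˢ T).filter fun x => x.1 + x.2 ∈ T)
      (fun x hx => by
        obtain ⟨h1, h2, h3⟩ := hsupp x hx
        simp [h1, h2, h3]),
    ← Finset.sum_fiberwise_of_maps_to (s := (T ×ˢ T).filter fun x => x.1 + x.2 ∈ T) (t := T)
      (g := fun x => x.1 + x.2) (fun x hx => (Finset.mem_filter.1 hx).2)]
  refine Finset.sum_congr rfl fun r hr => ?_
  have hr' := (hT r).1 hr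
  have hcoeff : ((Φ * Ψ : FracPowerSeries R[X]) : HahnSeries ℚ R[X]).coeff r =
      ∑ x ∈ ((T ×ˢ T).filter fun x => x.1 + x.2 ∈ T).filter fun x => x.1 + x.2 = r,
        (Φ : HahnSeries ℚ R[X]).coeff x.1 * (Ψ : HahnSeries ℚ R[X]).coeff x.2 := by
    rw [Subring.coe_mul, HahnSeries.coeff_mul]
    refine Finset.sum_subset ?_ ?_
    · intro x hx
      rw [Finset.mem_antidiagonal] at hx
      obtain ⟨h1, h2, h3⟩ := hx
      have := hnonneg _ (hΦ h1)
      have := hnonneg _ (hΨ h2)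
      simp only [Finset.mem_filter, Finset.mem_product]
      refine ⟨⟨⟨(hT _).2 ⟨hΦ h1, by linarith [hr'.2]⟩,
        (hT _).2 ⟨hΨ h2, by linarith [hr'.2]⟩⟩, ?_⟩, h3⟩
      rwa [h3]
    · intro x hx hx'
      by_contra h0
      refine hx' (Finset.mem_antidiagonal.2 ⟨left_ne_zero_of_mul h0, right_ne_zero_of_mul h0, ?_⟩)
      exact (Finset.mem_filter.1 hx).2
  rw [substFamily_apply, hcoeff, map_sum, Finset.mul_sum, HahnSeries.coeff_sum]
  refine Finset.sum_congr rfl fun x hx => ?_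
  rw [hterm, (Finset.mem_filter.1 hx).2]

/-- Substitution `u = U` as a ring homomorphism. -/
noncomputable def fracSubstHom (U : FracPowerSeries R) :
    FracPowerSeries R[X] →+* FracPowerSeries R where
  toFun := fracSubst U
  map_one' := by
    rw [← map_one (fracC : R[X] →+* _), fracSubst_fracC]
    simp [fracEval]
  map_mul' := fracSubst_mul U
  map_zero' := by
    rw [← map_zero (fracC : R[X] →+* _), fracSubst_fracC]
    simp [fracEval]
  map_add' := fracSubst_add U

theorem fracSubstHom_apply (U : FracPowerSeries R) (Φ : FracPowerSeries R[X]) :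
    fracSubstHom U Φ = fracSubst U Φ := rfl

variable (R) in
/-- The inclusion `R^fr[[t]][u] ⊆ R[u]^fr[[t]]`. -/
noncomputable def fracOfPoly : (FracPowerSeries R)[X] →+* FracPowerSeries R[X] :=
  eval₂RingHom (fracMapHom C) (fracC X)

@[simp]
theorem fracOfPoly_C (b : FracPowerSeries R) : fracOfPoly R (C b) = fracMap C b := by
  simp [fracOfPoly]
  rfl

@[simp]
theorem fracOfPoly_X : fracOfPoly R X = fracC X := by
  simp [fracOfPoly]

theorem fracSubst_fracOfPoly (U : FracPowerSeries R) (Q : (FracPowerSeries R)[X]) :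
    fracSubst U (fracOfPoly R Q) = Q.eval U := by
  have : (fracSubstHom U).comp (fracOfPoly R) = evalRingHom U := by
    ext1
    · ext1 b
      simp [fracSubstHom_apply, fracSubst_fracMap_C]
    · simp [fracSubstHom_apply, fracSubst_fracC, fracEval]
  exact congr($this Q)

/-- The derivative with respect to `u`, as an additive endomorphism of `R[u]^fr[[t]]`. -/
noncomputable def fracDeriv : FracPowerSeries R[X] →+ FracPowerSeries R[X] where
  toFun Φ := ⟨HahnSeries.map (Φ : HahnSeries ℚ R[X]) (derivative : R[X] →ₗ[R] R[X]), by
    obtain ⟨d, hd, h⟩ := Φ.2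
    refine ⟨d, hd, fun q hq => h fun h0 => hq ?_⟩
    simp [h0]⟩
  map_zero' := Subtype.ext <| by
    ext1
    funext q
    simp
  map_add' Φ Ψ := Subtype.ext <| by
    ext1
    funext q
    simp

theorem coeff_fracDeriv (Φ : FracPowerSeries R[X]) (q : ℚ) :
    (fracDeriv Φ : HahnSeries ℚ R[X]).coeff q =
      derivative ((Φ : HahnSeries ℚ R[X]).coeff q) := rfl

theorem fracDeriv_mul (Φ Ψ : FracPowerSeries R[X]) :
    fracDeriv (Φ * Ψ) = fracDeriv Φ * Ψ + Φ * fracDeriv Ψ := by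
  refine Subtype.ext ?_
  -- Differentiation does not enlarge supports, so all three products can be summed over the same
  -- antidiagonal.
  have hs : ∀ Θ : FracPowerSeries R[X], (fracDeriv Θ : HahnSeries ℚ R[X]).support ⊆
      (Θ : HahnSeries ℚ R[X]).support := fun Θ q hq h0 => hq (by rw [coeff_fracDeriv, h0]; simp)
  ext1
  funext q
  rw [coeff_fracDeriv, Subring.coe_mul, Subring.coe_add, HahnSeries.coeff_add, Subring.coe_mul,
    Subring.coe_mul, HahnSeries.coeff_mul,
    HahnSeries.coeff_mul_left' (Φ : HahnSeries ℚ R[X]).isPWO_support (hs Φ),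
    HahnSeries.coeff_mul_right' (Ψ : HahnSeries ℚ R[X]).isPWO_support (hs Ψ),
    ← Finset.sum_add_distrib, derivative_sum]
  exact Finset.sum_congr rfl fun x _ => by
    rw [derivative_mul, coeff_fracDeriv, coeff_fracDeriv]

theorem fracDeriv_fracOfPoly (Q : (FracPowerSeries R)[X]) :
    fracDeriv (fracOfPoly R Q) = fracOfPoly R (derivative Q) := by
  have hC : ∀ b : FracPowerSeries R, fracDeriv (fracMap C b) = 0 := fun b =>
    Subtype.ext <| by
      ext1
      funext q
      rw [coeff_fracDeriv]
      simp [fracMap]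
  have hX : fracDeriv (fracC (X : R[X])) = 1 := Subtype.ext <| by
    ext1
    funext q
    rw [coeff_fracDeriv]
    by_cases h : q = 0 <;> simp [coe_fracC, h, HahnSeries.coeff_one, HahnSeries.coeff_single_of_ne]
  induction Q using Polynomial.induction_on with
  | C b => simp [hC]
  | add p q hp hq => simp [hp, hq]
  | monomial n b ih =>
    rw [pow_succ, ← mul_assoc, map_mul, fracDeriv_mul, ih]
    simp [hX]

/-- Divisibility by a power of `u - U` descends from `R[u]^fr[[t]]` to `R^fr[[t]][u]`. -/
theorem pow_X_sub_C_dvd_of_fracOfPoly [IsDomain R] (U : FracPowerSeries R) (m : ℕ)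
    (Q : (FracPowerSeries R)[X])
    (h : (fracC (X : R[X]) - fracMap C U) ^ m ∣ fracOfPoly R Q) : (X - C U) ^ m ∣ Q := by
  induction m generalizing Q with
  | zero => simp
  | succ m ih =>
    obtain ⟨Ψ, hΨ⟩ := h
    have hlin : fracOfPoly R (X - C U) = fracC (X : R[X]) - fracMap C U := by simp
    -- Substituting `u = U` kills `u - U`, so `Q` has the root `U` and one linear factor can be
    -- divided out among polynomials.
    have h0 : Q.eval U = 0 := by
      rw [← fracSubst_fracOfPoly, hΨ, ← hlin, pow_succ, fracSubst_mul, fracSubst_mul,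
        fracSubst_fracOfPoly]
      simp
    obtain ⟨Q', rfl⟩ := dvd_iff_isRoot.2 h0
    -- The `u`-derivative of `u - U` is `1`, so `u - U` is nonzero and can be cancelled in the
    -- domain `R[u]^fr[[t]]`.
    have hne : fracC (X : R[X]) - fracMap C U ≠ 0 := by
      intro h0
      have h1 := fracDeriv_fracOfPoly (X - C U)
      rw [hlin, h0] at h1
      simp at h1
    rw [pow_succ']
    refine mul_dvd_mul_left _ (ih Q' ⟨Ψ, mul_left_cancel₀ hne ?_⟩)
    rw [← mul_assoc, ← pow_succ', ← hΨ, map_mul, hlin]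

end Substitution

/-! ### Evaluating `P` and `Δ` at the given series -/

section Evaluation

variable {K : Type*} [Field K] {k : ℕ}

theorem fracOfPowerSeries_C {R : Type*} [CommRing R] (r : R) :
    fracOfPowerSeries (PowerSeries.C r) = fracC r :=
  Subtype.ext (HahnSeries.ofPowerSeries_C r)

theorem fracMap_fracC {R S : Type*} [CommRing R] [CommRing S] (f : R →+* S) (r : R) :
    fracMap f (fracC r) = fracC (f r) :=
  Subtype.ext (HahnSeries.map_C r f)

theorem fracMap_fracOfPowerSeries {R S : Type*} [CommRing R] [CommRing S] (f : R →+* S)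
    (p : PowerSeries R) :
    fracMap f (fracOfPowerSeries p) = fracOfPowerSeries (PowerSeries.map f p) := by
  refine Subtype.ext ?_
  change HahnSeries.map (HahnSeries.ofPowerSeries ℚ R p) f =
    HahnSeries.ofPowerSeries ℚ S (PowerSeries.map f p)
  ext1
  funext q
  rw [HahnSeries.map_coeff]
  by_cases hq : ∃ n : ℕ, (n : ℚ) = q
  · obtain ⟨n, rfl⟩ := hq
    rw [HahnSeries.ofPowerSeries_apply_coeff, HahnSeries.ofPowerSeries_apply_coeff,
      PowerSeries.coeff_map]
  · rw [HahnSeries.ofPowerSeries_apply, HahnSeries.ofPowerSeries_apply,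
      HahnSeries.embDomain_of_notMem_range, HahnSeries.embDomain_of_notMem_range,
      map_zero] <;>
    simpa using hq

theorem finSuccEquiv_pderiv_zero {R : Type*} [CommRing R] (n : ℕ)
    (P : MvPolynomial (Fin (n + 1)) R) :
    MvPolynomial.finSuccEquiv R n (MvPolynomial.pderiv 0 P) =
      derivative (MvPolynomial.finSuccEquiv R n P) := by
  induction P using MvPolynomial.induction_on with
  | C a => simp [MvPolynomial.finSuccEquiv_apply]
  | add p q hp hq => simp [hp, hq]
  | mul_X p i hp =>
    rw [Derivation.leibniz, map_mul, derivative_mul, map_add, smul_eq_mul, smul_eq_mul, map_mul,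
      map_mul, hp]
    suffices h : MvPolynomial.finSuccEquiv R n (MvPolynomial.pderiv 0 (MvPolynomial.X i)) =
        derivative (MvPolynomial.finSuccEquiv R n (MvPolynomial.X i)) by
      rw [h]
      ring
    cases i using Fin.cases with
    | zero => simp [MvPolynomial.finSuccEquiv_X_zero]
    | succ j => simp [MvPolynomial.finSuccEquiv_X_succ]

/-- `evalParamPoly` as a ring homomorphism. -/
noncomputable def evalParamPolyHom (Fs : Fin k → PowerSeries K) :
    MvPolynomial (Fin (k + 2)) K →+* (FracPowerSeries (AlgebraicClosure K))[X] :=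
  MvPolynomial.eval₂Hom ((C).comp constK)
    (paramPoint (fun i => C (seriesK (Fs i))) (C (seriesK PowerSeries.X)) X)

theorem evalParamPolyHom_apply (Fs : Fin k → PowerSeries K) (D : MvPolynomial (Fin (k + 2)) K) :
    evalParamPolyHom Fs D = evalParamPoly D Fs := rfl

theorem map_paramPoint {A B : Type*} (φ : A → B) (x : Fin k → A) (t v : A) (i : Fin (k + 2)) :
    φ (paramPoint x t v i) = paramPoint (fun i => φ (x i)) (φ t) (φ v) i := by
  unfold paramPoint
  refine Fin.lastCases ?_ (fun i => ?_) i
  · simp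
  · refine Fin.lastCases ?_ (fun i => ?_) i <;> simp

theorem eval_evalParamPoly (D : MvPolynomial (Fin (k + 2)) K) (Fs : Fin k → PowerSeries K)
    (U : FracPowerSeries (AlgebraicClosure K)) :
    (evalParamPoly D Fs).eval U = evalParam D Fs U := by
  unfold evalParamPoly evalParam
  rw [← coe_evalRingHom, MvPolynomial.hom_eval₂]
  congr 1
  · ext; simp
  · funext i
    simp [map_paramPoint (evalRingHom U)]

theorem derivative_evalParamPoly (D : MvPolynomial (Fin (k + 2)) K) (Fs : Fin k → PowerSeries K) :
    derivative (evalParamPoly D Fs) = evalParamPoly (derivV D) Fs := by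
  simp only [← evalParamPolyHom_apply, derivV]
  induction D using MvPolynomial.induction_on with
  | C a => simp [evalParamPolyHom]
  | add p q hp hq => simp [hp, hq]
  | mul_X p i hp =>
    rw [Derivation.leibniz, map_mul, derivative_mul, map_add, smul_eq_mul, smul_eq_mul, map_mul,
      map_mul, hp]
    suffices h : derivative (evalParamPolyHom Fs (MvPolynomial.X i)) =
        evalParamPolyHom Fs (MvPolynomial.pderiv (Fin.last (k + 1)) (MvPolynomial.X i)) by
      rw [h]
      ring
    refine Fin.lastCases ?_ (fun j => ?_) i
    · simp [evalParamPolyHom, paramPoint]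
    · rw [MvPolynomial.pderiv_X_of_ne (Fin.castSucc_lt_last j).ne]
      refine Fin.lastCases ?_ (fun j => ?_) j <;> simp [evalParamPolyHom, paramPoint]

theorem iterate_derivative_evalParamPoly (D : MvPolynomial (Fin (k + 2)) K)
    (Fs : Fin k → PowerSeries K) (i : ℕ) :
    derivative^[i] (evalParamPoly D Fs) = evalParamPoly (derivV^[i] D) Fs := by
  induction i with
  | zero => rfl
  | succ i ih =>
    rw [Function.iterate_succ_apply', Function.iterate_succ_apply', ih, derivative_evalParamPoly]

theorem fracMap_C_constK (a : K) :
    fracMap C (constK a) = seriesKu (PowerSeries.C (C a)) := by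
  simp [constK, seriesKu, fracMap_fracC, fracOfPowerSeries_C]

theorem fracMap_C_seriesK (f : PowerSeries K) :
    fracMap C (seriesK f) = seriesKu (PowerSeries.map C f) := by
  simp only [seriesK, seriesKu, RingHom.comp_apply, fracMap_fracOfPowerSeries]
  congr 1
  ext1 n
  simp

theorem fracC_X_eq_seriesKu :
    fracC (X : (AlgebraicClosure K)[X]) = seriesKu (PowerSeries.C (X : K[X])) := by
  simp [seriesKu, fracOfPowerSeries_C]

/-- This identifies `P(F(u), F_1, …, F_k, t, u)` with the value at `F(u)` of a univariate polynomial
in `x_0`. The same coefficient map sends `discr₀ P` to `Δ(F_1, …, F_k, t, u)`, so the discriminant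
lemma applies. -/
theorem eval₂_finSuccEquiv (Q : MvPolynomial (Fin (k + 3)) K) (F : PowerSeries K[X])
    (Fs : Fin k → PowerSeries K) :
    (MvPolynomial.finSuccEquiv K (k + 2) Q).eval₂
      ((fracOfPoly (AlgebraicClosure K)).comp (evalParamPolyHom Fs)) (seriesKu F) =
      seriesKu (evalSeries Q F Fs) := by
  induction Q using MvPolynomial.induction_on with
  | C a =>
    simp [MvPolynomial.finSuccEquiv_apply, evalSeries, evalParamPolyHom, fracMap_C_constK]
  | add p q hp hq =>
    simp only [evalSeries] at hp hq ⊢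
    rw [map_add, eval₂_add, hp, hq, MvPolynomial.eval₂_add, map_add]
  | mul_X p i hp =>
    simp only [evalSeries] at hp ⊢
    rw [map_mul, eval₂_mul, hp, MvPolynomial.eval₂_mul, map_mul, MvPolynomial.eval₂_X]
    congr 1
    cases i using Fin.cases with
    | zero => simp [MvPolynomial.finSuccEquiv_X_zero, fullPoint]
    | succ j =>
      rw [MvPolynomial.finSuccEquiv_X_succ, eval₂_C, fullPoint, Fin.cons_succ,
        map_paramPoint seriesKu, RingHom.comp_apply, evalParamPolyHom, MvPolynomial.eval₂Hom_X',
        map_paramPoint (fracOfPoly (AlgebraicClosure K))]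
      simp [fracMap_C_seriesK, fracC_X_eq_seriesKu]

/-- Substitution `u = U` is a ring homomorphism, so it passes inside `Q`; this links the root
condition of the second claim to the series in `u`. -/
theorem fracSubst_seriesKu_evalSeries (Q : MvPolynomial (Fin (k + 3)) K) (F : PowerSeries K[X])
    (Fs : Fin k → PowerSeries K) (U : FracPowerSeries (AlgebraicClosure K)) :
    fracSubst U (seriesKu (evalSeries Q F Fs)) =
      evalFull Q (fracSubst U (seriesKu F)) Fs U := by
  unfold evalSeries evalFull
  rw [← fracSubstHom_apply, ← RingHom.comp_apply, MvPolynomial.hom_eval₂]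
  congr 1
  · ext1 a
    simp [← fracMap_C_constK, fracSubstHom_apply, fracSubst_fracMap_C]
  · funext i
    cases i using Fin.cases with
    | zero => simp [fullPoint, fracSubstHom_apply]
    | succ j =>
      have hX : seriesKu (PowerSeries.X : PowerSeries K[X]) =
          fracMap C (seriesK (PowerSeries.X)) := by
        rw [fracMap_C_seriesK, PowerSeries.map_X]
      rw [fullPoint, Fin.cons_succ, fullPoint, Fin.cons_succ,
        map_paramPoint ((fracSubstHom U).comp seriesKu)]
      simp [← fracMap_C_seriesK, ← fracC_X_eq_seriesKu, hX, fracSubstHom_apply,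
        fracSubst_fracMap_C, fracSubst_fracC, fracEval]

/-- `P'_0(F(u), F_1, …, F_k, t, u)²` divides the discriminant in `K̄[u]^fr[[t]]`. -/
theorem sq_seriesKu_pderiv_dvd (P : MvPolynomial (Fin (k + 3)) K) (F : PowerSeries K[X])
    (Fs : Fin k → PowerSeries K) (hF : evalSeries P F Fs = 0)
    (hdeg : 2 ≤ MvPolynomial.degreeOf 0 P) :
    seriesKu (evalSeries (MvPolynomial.pderiv 0 P) F Fs) ^ 2 ∣
      fracOfPoly (AlgebraicClosure K) (evalParamPoly (discr₀ P) Fs) := by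
  rw [← eval₂_finSuccEquiv, finSuccEquiv_pderiv_zero]
  refine sq_eval₂_derivative_dvd_map_discr _ _ ?_ _ ?_
  · rwa [MvPolynomial.natDegree_finSuccEquiv]
  · rw [eval₂_finSuccEquiv, hF, map_zero]

end Evaluation

/-! ### The two claims on multiple roots of `Δ` -/

theorem mainTheorem2 {K : Type*} [Field K] [CharZero K] (k : ℕ)
    (P : MvPolynomial (Fin (k + 3)) K)
    (F : PowerSeries (Polynomial K)) (Fs : Fin k → PowerSeries K)
    (hF : evalSeries P F Fs = 0)
    (hdeg : 2 ≤ MvPolynomial.degreeOf 0 P) :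
    (∀ (U : FracPowerSeries (AlgebraicClosure K)) (l : ℕ), 1 ≤ l →
      IsRootOfMultiplicity U l (seriesKu (evalSeries (MvPolynomial.pderiv 0 P) F Fs)) →
        (Polynomial.X - Polynomial.C U) ^ (2 * l) ∣ evalParamPoly (discr₀ P) Fs ∧
        ∀ i < 2 * l, evalParam (derivV^[i] (discr₀ P)) Fs U = 0) ∧
    (∀ U : Fin k → FracPowerSeries (AlgebraicClosure K),
      (∀ i, evalFull (MvPolynomial.pderiv 0 P) (fracSubst (U i) (seriesKu F)) Fs (U i) = 0) →
        ∀ i, evalParam (discr₀ P) Fs (U i) = 0 ∧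
          evalParam (derivV (discr₀ P)) Fs (U i) = 0) := by
  have hdvd := sq_seriesKu_pderiv_dvd P F Fs hF hdeg
  refine ⟨fun U l _ ⟨Ψ, hΨ, _⟩ => ?_, fun U hU i => ?_⟩
  · have h : (X - C U) ^ (2 * l) ∣ evalParamPoly (discr₀ P) Fs := by
      refine pow_X_sub_C_dvd_of_fracOfPoly U _ _ (dvd_trans ?_ hdvd)
      rw [hΨ, mul_pow, ← pow_mul, mul_comm l 2]
      exact dvd_mul_right _ _
    refine ⟨h, fun i hi => ?_⟩
    rw [← eval_evalParamPoly, ← iterate_derivative_evalParamPoly]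
    -- The `i`-th derivative keeps the factor `(v - U)^(2l - i)`, of positive exponent.
    obtain ⟨Q, hQ⟩ := (pow_sub_dvd_iterate_derivative_of_pow_dvd i h)
    rw [hQ]
    simp [zero_pow (Nat.sub_pos_of_lt hi).ne']
  · specialize hU i
    rw [← fracSubst_seriesKu_evalSeries, ← fracSubstHom_apply] at hU
    -- No multiplicity is used: none exists when `P'_0(F(u), …)` is identically zero. In `Δ = P'_0²
    -- D`, both `Δ` and its `u`-derivative retain a factor `P'_0`, which vanishes at `u = U`.
    obtain ⟨D, hD⟩ := hdvd
    rw [← eval_evalParamPoly, ← eval_evalParamPoly, ← derivative_evalParamPoly,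
      ← fracSubst_fracOfPoly, ← fracSubst_fracOfPoly, ← fracDeriv_fracOfPoly, hD,
      ← fracSubstHom_apply, ← fracSubstHom_apply]
    constructor
    · simp [hU]
    · rw [pow_two, fracDeriv_mul, fracDeriv_mul]
      simp [hU]
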